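/- Let $A=(a_n)_{n\in\mathbb N}$, $a_n=(a_n(i))_{i\in\mathbb N}$, be a Köthe matrix, that is, $0\le a_n(i)\le a_{n+1}(i)$ for all $i,n\in\mathbb N$, and for each $i$ there is $n$ with $a_n(i)>0$. Let $$\lambda_0(A)=\Big\{x\in\mathbb C^{\mathbb N}:\ \lim_{i\to\infty}a_n(i)\,x_i=0\ \text{ for all } n\in\mathbb N\Big\}$$ be the Köthe echelon space of order $0$, with the Fréchet space topology defined by the seminorms $p_n(x)=\sup_i a_n(i)|x_i|$, $n\in\mathbb N$. Suppose that $\lambda_0(A)$ is a $G_1$-space, that is, (G1-1) $0<a_n(i+1)\le a_n(i)$ for all $n,i\in\mathbb N$; (G1-2) for each $n\in\mathbb N$ there are $m>n$ and $C>0$ such that $a_n(i)\le C\,a_m(i)^2$ for all $i\in\mathbb N$. Then the Cesàro operator $\mathsf C\colon\lambda_0(A)\to\lambda_0(A)$, $\mathsf Cx=\big(\tfrac1i\sum_{j=1}^i x_j\big)_{i\in\mathbb N}$, is a continuous linear operator on $\lambda_0(A)$. Let its spectrum $\sigma(\mathsf C;\lambda_0(A))$ be the set of all $\lambda\in\mathbb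 C$ for which $\lambda I-\mathsf C$ has no inverse in the algebra of continuous linear operators on $\lambda_0(A)$. If, in addition, $\lambda_0(A)$ is a nuclear space, then $$\sigma(\mathsf C;\lambda_0(A))=\Big\{\tfrac1k:\ k\in\mathbb N\Big\},\qquad \mathbb N=\{1,2,3,\dots\}.$$ -/

import Mathlib

open Filter Topology

/-- A Köthe matrix `A = (a_n)_n`, `a_n = (a_n(i))_i`. The index set of both the rows and the
coordinates is `{0, 1, 2, ...}`: the coordinate with index `i` here is the coordinate number `i + 1`
in the convention in which sequences start with index `1`. -/
structure KotheMatrix where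
  /-- The entry `a_n(i)`. -/
  a : ℕ → ℕ → ℝ
  nonneg : ∀ n i, 0 ≤ a n i
  mono : ∀ n i, a n i ≤ a (n + 1) i
  exists_pos : ∀ i, ∃ n, 0 < a n i

namespace KotheMatrix

/-- The conditions (G1-1) and (G1-2), under which `λ₀(A)` is a smooth sequence space of
finite type (a `G₁`-space). -/
structure IsG1 (A : KotheMatrix) : Prop where
  pos : ∀ n i, 0 < A.a n (i + 1)
  anti : ∀ n i, A.a n (i + 1) ≤ A.a n i
  sq : ∀ n, ∃ m, n < m ∧ ∃ C : ℝ, 0 < C ∧ ∀ i, A.a n i ≤ C * A.a m i ^ 2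

/-- `λ₀(A)` as a linear subspace of the space of all complex sequences. -/
def echelon (A : KotheMatrix) : Submodule ℂ (ℕ → ℂ) where
  carrier := {x | ∀ n, Tendsto (fun i => (A.a n i : ℂ) * x i) atTop (𝓝 0)}
  zero_mem' := by
    intro n
    simp
  add_mem' := by
    intro x y hx hy n
    simpa [mul_add] using (hx n).add (hy n)
  smul_mem' := by
    intro c x hx n
    have h := (hx n).const_mul c
    simpa [mul_left_comm] using h

/-- The Köthe echelon space `λ₀(A)` of order zero. It is a type of its own, since its topology is
not the one induced by the product topology. -/
def Lambda0 (A : KotheMatrix) : Type := A.echelon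

namespace Lambda0

variable {A : KotheMatrix}

noncomputable instance : AddCommGroup (Lambda0 A) := inferInstanceAs (AddCommGroup A.echelon)

noncomputable instance : Module ℂ (Lambda0 A) := inferInstanceAs (Module ℂ A.echelon)

/-- The sequence underlying an element of `λ₀(A)`, as a linear map. -/
def seq : Lambda0 A →ₗ[ℂ] (ℕ → ℂ) := A.echelon.subtype

theorem tendsto_seq (x : Lambda0 A) (n : ℕ) :
    Tendsto (fun i => (A.a n i : ℂ) * seq x i) atTop (𝓝 0) := x.2 n

theorem tendsto_norm (x : Lambda0 A) (n : ℕ) :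
    Tendsto (fun i => A.a n i * ‖seq x i‖) atTop (𝓝 0) := by
  have h := (tendsto_seq x n).norm
  simpa [abs_of_nonneg (A.nonneg n _)] using h

theorem bddAbove (x : Lambda0 A) (n : ℕ) :
    BddAbove (Set.range fun i => A.a n i * ‖seq x i‖) :=
  (tendsto_norm x n).bddAbove_range

theorem le_sup (x : Lambda0 A) (n i : ℕ) :
    A.a n i * ‖seq x i‖ ≤ ⨆ i, A.a n i * ‖seq x i‖ :=
  le_ciSup (bddAbove x n) i

/-- The seminorm `p_n(x) = sup_i a_n(i) |x_i|`. -/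
noncomputable def p (A : KotheMatrix) (n : ℕ) : Seminorm ℂ (Lambda0 A) :=
  Seminorm.ofSMulLE (fun x => ⨆ i, A.a n i * ‖seq x i‖)
    (by simp)
    (by
      intro x y
      refine ciSup_le fun i => ?_
      have h1 := le_sup x n i
      have h2 := le_sup y n i
      have h3 := mul_le_mul_of_nonneg_left (norm_add_le (seq x i) (seq y i)) (A.nonneg n i)
      have h4 : seq (x + y) i = seq x i + seq y i := by rw [map_add]; rfl
      rw [h4]
      linarith)
    (by
      intro c x
      refine ciSup_le fun i => ?_
      have h1 := mul_le_mul_of_nonneg_left (le_sup x n i) (norm_nonneg c)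
      have h4 : seq (c • x) i = c * seq x i := by rw [map_smul]; rfl
      rw [h4, norm_mul]
      linarith)

theorem p_apply (n : ℕ) (x : Lambda0 A) : p A n x = ⨆ i, A.a n i * ‖seq x i‖ := rfl

/-- The locally convex topology of `λ₀(A)` defined by the seminorms `p_n`. -/
noncomputable instance : TopologicalSpace (Lambda0 A) :=
  (SeminormFamily.moduleFilterBasis (𝕜 := ℂ) (p A)).topology

theorem withSeminorms (A : KotheMatrix) : WithSeminorms (p A) := ⟨rfl⟩

instance : IsTopologicalAddGroup (Lambda0 A) := (withSeminorms A).topologicalAddGroup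

instance : ContinuousSMul ℂ (Lambda0 A) := (withSeminorms A).continuousSMul

end Lambda0

end KotheMatrix

/-- The Cesàro operator `x ↦ ((x_0 + ... + x_i) / (i + 1))_i` on the space of all complex
sequences. -/
noncomputable def cesaroSeq : (ℕ → ℂ) →ₗ[ℂ] (ℕ → ℂ) where
  toFun x i := (∑ j ∈ Finset.range (i + 1), x j) / ((i : ℂ) + 1)
  map_add' := by
    intro x y
    funext i
    simp [Finset.sum_add_distrib, add_div]
  map_smul' := by
    intro c x
    funext i
    simp [← Finset.mul_sum, mul_div_assoc]

namespace KotheMatrix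

theorem IsG1.antitone {A : KotheMatrix} (hA : A.IsG1) (n : ℕ) : Antitone (A.a n) :=
  antitone_nat_of_succ_le (hA.anti n)

theorem IsG1.cesaro_bound {A : KotheMatrix} (hA : A.IsG1) (n : ℕ) (x : ℕ → ℂ) (i : ℕ) :
    A.a n i * ‖cesaroSeq x i‖ ≤
      ((i + 1 : ℕ) : ℝ)⁻¹ * ∑ j ∈ Finset.range (i + 1), A.a n j * ‖x j‖ := by
  have h1 : ‖cesaroSeq x i‖ = ((i + 1 : ℕ) : ℝ)⁻¹ * ‖∑ j ∈ Finset.range (i + 1), x j‖ := by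
    have h2 : cesaroSeq x i = (∑ j ∈ Finset.range (i + 1), x j) / ((i + 1 : ℕ) : ℂ) := by
      push_cast
      rfl
    rw [h2, norm_div, Complex.norm_natCast, div_eq_inv_mul]
  rw [h1, mul_left_comm]
  refine mul_le_mul_of_nonneg_left ?_ (by positivity)
  refine (mul_le_mul_of_nonneg_left (norm_sum_le _ _) (A.nonneg n i)).trans ?_
  rw [Finset.mul_sum]
  refine Finset.sum_le_sum fun j hj => ?_
  exact mul_le_mul_of_nonneg_right
    (hA.antitone n (Nat.lt_succ_iff.mp (Finset.mem_range.mp hj))) (norm_nonneg _)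

theorem IsG1.cesaro_mem {A : KotheMatrix} (hA : A.IsG1) (x : Lambda0 A) :
    cesaroSeq (Lambda0.seq x) ∈ A.echelon := by
  intro n
  have h := ((Lambda0.tendsto_norm x n).cesaro).comp (tendsto_add_atTop_nat 1)
  rw [tendsto_zero_iff_norm_tendsto_zero]
  refine squeeze_zero (fun i => norm_nonneg _) (fun i => ?_) h
  have h1 := hA.cesaro_bound n (Lambda0.seq x) i
  simpa [abs_of_nonneg (A.nonneg n _)] using h1

/-- The Cesàro operator on `λ₀(A)`, as a linear map. -/
noncomputable def cesaroLin (A : KotheMatrix) (hA : A.IsG1) : Lambda0 A →ₗ[ℂ] Lambda0 A :=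
  (cesaroSeq ∘ₗ Lambda0.seq).codRestrict A.echelon hA.cesaro_mem

theorem p_cesaroLin_le (A : KotheMatrix) (hA : A.IsG1) (n : ℕ) (x : Lambda0 A) :
    Lambda0.p A n (cesaroLin A hA x) ≤ Lambda0.p A n x := by
  refine ciSup_le fun i => (hA.cesaro_bound n (Lambda0.seq x) i).trans ?_
  rw [inv_mul_le_iff₀ (by positivity)]
  refine (Finset.sum_le_card_nsmul _ _ _ fun j _ => Lambda0.le_sup x n j).trans_eq ?_
  rw [Finset.card_range, nsmul_eq_mul, Lambda0.p_apply]

/-- The Cesàro operator `C ∈ L(λ₀(A))` on a `G₁`-space: it acts on `λ₀(A)` by the formula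
of `cesaroSeq`, and is continuous. -/
noncomputable def cesaro (A : KotheMatrix) (hA : A.IsG1) : Lambda0 A →L[ℂ] Lambda0 A where
  toLinearMap := cesaroLin A hA
  cont := by
    refine WithSeminorms.continuous_of_isBounded (Lambda0.withSeminorms A) (Lambda0.withSeminorms A)
      _ fun n => ⟨{n}, 1, fun x => ?_⟩
    simpa using p_cesaroLin_le A hA n x

theorem seq_cesaro (A : KotheMatrix) (hA : A.IsG1) (x : Lambda0 A) (i : ℕ) :
    Lambda0.seq (cesaro A hA x) i =
      (∑ j ∈ Finset.range (i + 1), Lambda0.seq x j) / ((i : ℂ) + 1) := rfl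

end KotheMatrix

/-- Nuclearity of a locally convex space `E`: for every continuous seminorm `p` there is a continuous
seminorm `q ≥ p` such that the canonical map from `E_q` to the completion of `E_p` is nuclear, where
`E_p` is the normed space `E / ker p`. That is, this map has the form `x ↦ ∑ c_k f_k(x) y_k`
with `∑ |c_k| < ∞`, functionals `f_k` of norm at most one with respect to `q`, and
vectors `y_k` of norm at most one with respect to `p`, the series converging with respect to `p`.
(Each vector of the completion of `E_p` is the sum of an absolutely convergent series of
vectors of `E_p`, so it is no restriction to take the `y_k` from `E`.) -/
def IsNuclearSpace (E : Type*) [AddCommGroup E] [Module ℂ E] [TopologicalSpace E] : Prop :=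
  ∀ p : Seminorm ℂ E, Continuous p →
    ∃ q : Seminorm ℂ E, Continuous q ∧ p ≤ q ∧
      ∃ (c : ℕ → ℂ) (f : ℕ → E →ₗ[ℂ] ℂ) (y : ℕ → E),
        Summable (fun k => ‖c k‖) ∧ (∀ k x, ‖f k x‖ ≤ q x) ∧ (∀ k, p (y k) ≤ 1) ∧
        ∀ x, Tendsto (fun N => p (x - ∑ k ∈ Finset.range N, (c k * f k x) • y k)) atTop (𝓝 0)

/-!
The Cesàro operator on a nuclear `G₁`-space has spectrum `{1 / k : k ≥ 1}`.

Nuclearity enters only through the growth of the weights. The coordinate functionals and the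
unit vectors form a biorthogonal system, so the trace of the projection onto the first `M`
coordinates, weighted by `a_n`, can be computed from a nuclear representation of the canonical map;
this bounds `∑_{i < M} a_n(i)` independently of `M` (`sum_weight_bounded`). As `a_n` is
decreasing, `(i + 1) a_n(i)` is bounded, and condition (G1-2) improves this to
`(i + 1) ^ N * a_n(i) ≤ C * a_m(i)` for each `N` (`pow_mul_weight_le`): sequences that grow
polynomially faster than elements of `λ₀(A)` still belong to `λ₀(A)`.

If `(z - C) x = y`, the partial sums `s_i` of `x` solve the first-order recursion
`(z - 1 / (i + 1)) s_{i+1} = z s_i + y_i`. When `z` is not of the form `1 / k`, the recursion can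
be solved and its solutions grow at most polynomially in comparison with the sums of `‖y_j‖`
(`norm_le_of_recursion`), which makes `z - C` bijective with a continuous inverse. The value
`z = 0` needs no separate treatment: there the recursion reads `s_{i+1} = -(i + 1) y_i`.

If `z = 1 / k`, the matrix of `z - C` is lower triangular and its `k`-th diagonal entry is its first
zero, so the `k`-th unit vector is not in the range.
-/

namespace KotheMatrix

variable {A : KotheMatrix}

/-! ### Unit vectors and growth of the weights -/

theorem IsG1.weight_pos (hA : A.IsG1) (n i : ℕ) : 0 < A.a n i :=
  (hA.pos n i).trans_le (hA.anti n i)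

namespace Lambda0

@[ext]
theorem ext {x y : Lambda0 A} (h : ∀ i, seq x i = seq y i) : x = y :=
  Subtype.ext (funext h)

/-- The element of `λ₀(A)` with a given underlying sequence. -/
def mk (x : ℕ → ℂ) (hx : ∀ n, Tendsto (fun i => A.a n i * ‖x i‖) atTop (𝓝 0)) : Lambda0 A :=
  ⟨x, fun n => by
    rw [tendsto_zero_iff_norm_tendsto_zero]
    simpa [abs_of_nonneg (A.nonneg n _)] using hx n⟩

@[simp]
theorem seq_mk (x : ℕ → ℂ) (hx : ∀ n, Tendsto (fun i => A.a n i * ‖x i‖) atTop (𝓝 0)) :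
    seq (mk x hx) = x := rfl

/-- The unit vector with a `1` in position `k`. -/
noncomputable def unit (A : KotheMatrix) (k : ℕ) : Lambda0 A :=
  mk (Pi.single k 1) fun n => tendsto_const_nhds.congr' <| by
    filter_upwards [eventually_gt_atTop k] with i hi
    simp [Pi.single_eq_of_ne hi.ne']

@[simp]
theorem seq_unit (k : ℕ) : seq (unit A k) = Pi.single k 1 := rfl

theorem seq_sum_smul_unit (M : ℕ) (b : ℕ → ℂ) (i : ℕ) :
    seq (∑ j ∈ Finset.range M, b j • unit A j) i = if i < M then b i else 0 := by
  simp [map_sum, Finset.sum_apply, Pi.single_apply]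

theorem p_le {n : ℕ} {x : Lambda0 A} {B : ℝ} (h : ∀ i, A.a n i * ‖seq x i‖ ≤ B) :
    p A n x ≤ B := ciSup_le h

theorem weight_mul_norm_le_p (x : Lambda0 A) (n i : ℕ) : A.a n i * ‖seq x i‖ ≤ p A n x :=
  le_sup x n i

theorem continuous_p (n : ℕ) : Continuous (p A n) :=
  (withSeminorms A).continuous_seminorm n

end Lambda0

open Lambda0

/-- In a nuclear `G₁`-space all weights are summable. For a nuclear representation
`x = ∑ c_k f_k(x) y_k` with respect to `p_n`, the sum `∑_{i < M} a_n(i)` is the trace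
`∑_k c_k f_k(∑_{i < M} a_n(i) y_k(i) e_i)`, and the arguments of the `f_k` form a bounded set. -/
theorem IsG1.sum_weight_bounded (hA : A.IsG1) (hN : IsNuclearSpace A.Lambda0) (n : ℕ) :
    ∃ B : ℝ, 0 < B ∧ ∀ M, ∑ i ∈ Finset.range M, A.a n i ≤ B := by
  obtain ⟨q, hq, -, c, f, y, hc, hf, hy, hlim⟩ := hN (p A n) (continuous_p n)
  obtain ⟨t, C, -, hqC⟩ := Seminorm.bound_of_continuous (withSeminorms A) q hq
  set R : ℝ := ∑ j ∈ t, A.a j 0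
  have hR0 : 0 ≤ R := Finset.sum_nonneg fun j _ => A.nonneg j 0
  have hya : ∀ k i, A.a n i * ‖seq (y k) i‖ ≤ 1 := fun k i =>
    (weight_mul_norm_le_p (y k) n i).trans (hy k)
  have hfbound : ∀ M k,
      ‖f k (∑ i ∈ Finset.range M, ((A.a n i : ℂ) * seq (y k) i) • unit A i)‖ ≤ C * R := by
    intro M k
    refine (hf k _).trans ((hqC _).trans ?_)
    rw [smul_apply, NNReal.smul_def, smul_eq_mul]
    refine mul_le_mul_of_nonneg_left (Seminorm.finset_sup_apply_le hR0 fun j hj => ?_) C.2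
    refine p_le fun i => ?_
    rw [seq_sum_smul_unit]
    have hjR : A.a j 0 ≤ R :=
      Finset.single_le_sum (f := fun j => A.a j 0) (fun j _ => A.nonneg j 0) hj
    split_ifs with hi
    · rw [norm_mul, Complex.norm_real, Real.norm_of_nonneg (A.nonneg n i)]
      calc A.a j i * (A.a n i * ‖seq (y k) i‖) ≤ A.a j i * 1 :=
            mul_le_mul_of_nonneg_left (hya k i) (A.nonneg j i)
        _ ≤ R := by
            rw [mul_one]
            exact (hA.antitone j (Nat.zero_le i)).trans hjR
    · simpa using hR0
  have hcoord : ∀ i, Tendsto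
      (fun N => ∑ k ∈ Finset.range N, c k * f k (unit A i) * seq (y k) i) atTop (𝓝 1) := by
    intro i
    have hpos := hA.weight_pos n i
    rw [tendsto_iff_norm_sub_tendsto_zero]
    have h := (hlim (unit A i)).const_mul (A.a n i)⁻¹
    rw [mul_zero] at h
    refine squeeze_zero (fun _ => norm_nonneg _) (fun N => ?_) h
    rw [inv_mul_eq_div, le_div_iff₀' hpos]
    refine le_trans (le_of_eq ?_) (weight_mul_norm_le_p _ n i)
    rw [norm_sub_rev]
    simp [map_sub, map_sum, Finset.sum_apply]
  refine ⟨C * R * ∑' k, ‖c k‖ + 1, add_pos_of_nonneg_of_pos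
    (mul_nonneg (mul_nonneg C.2 hR0) (tsum_nonneg fun k => norm_nonneg (c k))) one_pos, fun M => ?_⟩
  have htrace : Tendsto (fun N => ∑ k ∈ Finset.range N,
      c k * f k (∑ i ∈ Finset.range M, ((A.a n i : ℂ) * seq (y k) i) • unit A i)) atTop
      (𝓝 ((∑ i ∈ Finset.range M, A.a n i : ℝ) : ℂ)) := by
    have h := tendsto_finsetSum (Finset.range M) fun i _ =>
      (hcoord i).const_mul (A.a n i : ℂ)
    simp only [mul_one] at h
    push_cast
    refine h.congr fun N => ?_
    simp only [Finset.mul_sum, map_sum, map_smul, smul_eq_mul]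
    rw [Finset.sum_comm]
    exact Finset.sum_congr rfl fun k _ => Finset.sum_congr rfl fun i _ => by ring
  have hle := le_of_tendsto htrace.norm (b := C * R * ∑' k, ‖c k‖) <|
      Eventually.of_forall fun N => by
    refine (norm_sum_le _ _).trans ?_
    calc ∑ k ∈ Finset.range N, ‖c k *
            f k (∑ i ∈ Finset.range M, ((A.a n i : ℂ) * seq (y k) i) • unit A i)‖
          ≤ ∑ k ∈ Finset.range N, C * R * ‖c k‖ := Finset.sum_le_sum fun k _ => by
            rw [norm_mul, mul_comm]
            exact mul_le_mul_of_nonneg_right (hfbound M k) (norm_nonneg _)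
      _ ≤ C * R * ∑' k, ‖c k‖ := by
            rw [← Finset.mul_sum]
            exact mul_le_mul_of_nonneg_left (hc.sum_le_tsum _ fun k _ => norm_nonneg _)
              (mul_nonneg C.2 hR0)
  rw [Complex.norm_real] at hle
  linarith [le_abs_self (∑ i ∈ Finset.range M, A.a n i), Real.norm_eq_abs
    (∑ i ∈ Finset.range M, A.a n i)]

theorem IsG1.succ_mul_weight_le (hA : A.IsG1) (hN : IsNuclearSpace A.Lambda0) (n : ℕ) :
    ∃ m, ∃ C : ℝ, 0 < C ∧ ∀ i : ℕ, ((i : ℝ) + 1) * A.a n i ≤ C * A.a m i := by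
  obtain ⟨m, -, C, hC, hm⟩ := hA.sq n
  obtain ⟨B, hB, hsum⟩ := hA.sum_weight_bounded hN m
  refine ⟨m, C * B, by positivity, fun i => ?_⟩
  have h1 : ((i : ℝ) + 1) * A.a m i ≤ B := by
    refine le_trans ?_ (hsum (i + 1))
    have h := Finset.card_nsmul_le_sum (Finset.range (i + 1)) (A.a m) (A.a m i) fun j hj =>
      hA.antitone m (Nat.lt_succ_iff.mp (Finset.mem_range.mp hj))
    simpa using h
  calc ((i : ℝ) + 1) * A.a n i ≤ (i + 1) * (C * A.a m i ^ 2) :=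
        mul_le_mul_of_nonneg_left (hm i) (by positivity)
    _ = C * (((i : ℝ) + 1) * A.a m i) * A.a m i := by ring
    _ ≤ C * B * A.a m i := by
        have := A.nonneg m i
        gcongr

/-- In other words: on a nuclear `G₁`-space, multiplication by a power of the index is a
continuous operator. -/
theorem IsG1.pow_mul_weight_le (hA : A.IsG1) (hN : IsNuclearSpace A.Lambda0) (N n : ℕ) :
    ∃ m, ∃ C : ℝ, 0 < C ∧ ∀ i : ℕ, ((i : ℝ) + 1) ^ N * A.a n i ≤ C * A.a m i := by
  induction N generalizing n with
  | zero => exact ⟨n, 1, one_pos, fun i => by simp⟩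
  | succ N ih =>
    obtain ⟨m, C, hC, hm⟩ := hA.succ_mul_weight_le hN n
    obtain ⟨l, D, hD, hl⟩ := ih m
    refine ⟨l, C * D, by positivity, fun i => ?_⟩
    calc ((i : ℝ) + 1) ^ (N + 1) * A.a n i = (i + 1) ^ N * ((i + 1) * A.a n i) := by ring
      _ ≤ (i + 1) ^ N * (C * A.a m i) := mul_le_mul_of_nonneg_left (hm i) (by positivity)
      _ = C * ((i + 1) ^ N * A.a m i) := by ring
      _ ≤ C * (D * A.a l i) := mul_le_mul_of_nonneg_left (hl i) hC.le
      _ = C * D * A.a l i := by ring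

end KotheMatrix

/-! ### The recursion for the partial sums -/

theorem exists_bound_inv_sub {z : ℂ} (hz : ∀ i : ℕ, z ≠ 1 / ((i : ℂ) + 1)) :
    ∃ N : ℕ, ∀ i : ℕ, ‖(z - 1 / ((i : ℂ) + 1))⁻¹‖ ≤ N * ((i : ℝ) + 1) ∧
      ‖z * (z - 1 / ((i : ℂ) + 1))⁻¹‖ ≤ 1 + N / ((i : ℝ) + 1) := by
  have hnorm : ∀ i : ℕ, ‖(i : ℂ) + 1‖ = (i : ℝ) + 1 := fun i => by
    exact_mod_cast Complex.norm_natCast (i + 1)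
  rcases eq_or_ne z 0 with rfl | hz0
  · refine ⟨1, fun i => ⟨?_, ?_⟩⟩
    · rw [zero_sub, norm_inv, norm_neg, norm_div, norm_one, hnorm, one_div, inv_inv, Nat.cast_one,
        one_mul]
    · rw [zero_mul, norm_zero]
      positivity
  · have hlim : Tendsto (fun i : ℕ => ‖(z - 1 / ((i : ℂ) + 1))⁻¹‖) atTop (𝓝 ‖z⁻¹‖) := by
      have h := tendsto_const_nhds (x := z).sub (tendsto_one_div_add_atTop_nhds_zero_nat (𝕜 := ℂ))
      rw [sub_zero] at h
      exact (h.inv₀ hz0).norm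
    obtain ⟨B, hB⟩ := hlim.bddAbove_range
    obtain ⟨N, hBN⟩ := exists_nat_ge B
    have hN : ∀ i : ℕ, ‖(z - 1 / ((i : ℂ) + 1))⁻¹‖ ≤ N := fun i =>
      (hB ⟨i, rfl⟩).trans hBN
    refine ⟨N, fun i => ⟨(hN i).trans ?_, ?_⟩⟩
    · exact le_mul_of_one_le_right (by positivity) (by simp)
    · have h1 : z - 1 / ((i : ℂ) + 1) ≠ 0 := sub_ne_zero.mpr (hz i)
      have h2 : z * (z - 1 / ((i : ℂ) + 1))⁻¹ =
          1 + (z - 1 / ((i : ℂ) + 1))⁻¹ / ((i : ℂ) + 1) := by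
        linear_combination mul_inv_cancel₀ h1
      rw [h2]
      refine (norm_add_le _ _).trans ?_
      rw [norm_one, norm_div, hnorm]
      gcongr
      exact hN i

/-- Solutions of the recursion for the partial sums of a solution `x` of `(z - C) x = y` are
bounded by a power of the index times the partial sums of `‖y_j‖`. -/
theorem norm_le_of_recursion {z : ℂ} (hz : ∀ i : ℕ, z ≠ 1 / ((i : ℂ) + 1)) :
    ∃ (N : ℕ) (K : ℝ), 0 ≤ K ∧ ∀ S y : ℕ → ℂ, S 0 = 0 →
      (∀ i : ℕ, (z - 1 / ((i : ℂ) + 1)) * S (i + 1) = z * S i + y i) →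
      ∀ i : ℕ, ‖S (i + 1)‖ ≤ K * ((i : ℝ) + 1) ^ N * ∑ j ∈ Finset.range (i + 1), ‖y j‖ := by
  obtain ⟨N, hN⟩ := exists_bound_inv_sub hz
  refine ⟨N + 1, N * 2 ^ N, by positivity, fun S y hS0 hS i => ?_⟩
  have key : ∀ k : ℕ, ‖S k‖ ≤
      N * ((k : ℝ) + 1) ^ N * ∑ j ∈ Finset.range k, ((j : ℝ) + 1) * ‖y j‖ := by
    intro k
    induction k with
    | zero => simp [hS0]
    | succ k ih =>
      set T : ℝ := ∑ j ∈ Finset.range k, ((j : ℝ) + 1) * ‖y j‖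
      have hT : 0 ≤ T := Finset.sum_nonneg fun j _ => by positivity
      have hne : z - 1 / ((k : ℂ) + 1) ≠ 0 := sub_ne_zero.mpr (hz k)
      have hSk : S (k + 1) = z * (z - 1 / ((k : ℂ) + 1))⁻¹ * S k +
          (z - 1 / ((k : ℂ) + 1))⁻¹ * y k := by
        rw [← inv_mul_cancel_left₀ hne (S (k + 1)), hS k]
        ring
      -- Bernoulli's inequality turns the growth factor `1 + N / (k + 1)` into a telescoping product.
      have hbern : (1 + N / ((k : ℝ) + 1)) * ((k : ℝ) + 1) ^ N ≤ ((k : ℝ) + 2) ^ N := by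
        have h := one_add_mul_le_pow (a := 1 / ((k : ℝ) + 1))
          (le_trans (by norm_num) (by positivity : (0 : ℝ) ≤ 1 / ((k : ℝ) + 1))) N
        have h2 : ((k : ℝ) + 2) ^ N = (1 + 1 / ((k : ℝ) + 1)) ^ N * ((k : ℝ) + 1) ^ N := by
          rw [← mul_pow]
          congr 1
          field_simp
          ring
        rw [h2]
        refine mul_le_mul_of_nonneg_right (le_trans (le_of_eq ?_) h) (by positivity)
        ring
      have hpow : (1 : ℝ) ≤ ((k : ℝ) + 2) ^ N := one_le_pow₀ (by linarith [k.cast_nonneg (α := ℝ)])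
      rw [hSk, Finset.sum_range_succ]
      refine (norm_add_le _ _).trans ?_
      rw [norm_mul (_ * _) (S k), norm_mul _ (y k)]
      calc ‖z * (z - 1 / ((k : ℂ) + 1))⁻¹‖ * ‖S k‖ + ‖(z - 1 / ((k : ℂ) + 1))⁻¹‖ * ‖y k‖
          ≤ (1 + N / ((k : ℝ) + 1)) * (N * ((k : ℝ) + 1) ^ N * T)
            + N * ((k : ℝ) + 1) * ‖y k‖ := by
            gcongr
            · exact (hN k).2
            · exact (hN k).1
        _ = ((1 + N / ((k : ℝ) + 1)) * ((k : ℝ) + 1) ^ N) * (N * T)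
            + 1 * (N * (((k : ℝ) + 1) * ‖y k‖)) := by ring
        _ ≤ ((k : ℝ) + 2) ^ N * (N * T) + ((k : ℝ) + 2) ^ N * (N * (((k : ℝ) + 1) * ‖y k‖)) := by
            gcongr
        _ = N * (((k + 1 : ℕ) : ℝ) + 1) ^ N * (T + ((k : ℝ) + 1) * ‖y k‖) := by
            push_cast
            ring
  refine (key (i + 1)).trans ?_
  have h1 : (((i + 1 : ℕ) : ℝ) + 1) ^ N ≤ 2 ^ N * ((i : ℝ) + 1) ^ N := by
    rw [← mul_pow]
    refine pow_le_pow_left₀ (by positivity) ?_ N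
    push_cast
    linarith [i.cast_nonneg (α := ℝ)]
  have h2 : ∑ j ∈ Finset.range (i + 1), ((j : ℝ) + 1) * ‖y j‖ ≤
      ((i : ℝ) + 1) * ∑ j ∈ Finset.range (i + 1), ‖y j‖ := by
    rw [Finset.mul_sum]
    refine Finset.sum_le_sum fun j hj => ?_
    have hji : (j : ℝ) ≤ i := by exact_mod_cast Nat.lt_succ_iff.mp (Finset.mem_range.mp hj)
    gcongr
  calc (N : ℝ) * (((i + 1 : ℕ) : ℝ) + 1) ^ N * ∑ j ∈ Finset.range (i + 1), ((j : ℝ) + 1) * ‖y j‖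
      ≤ N * (2 ^ N * ((i : ℝ) + 1) ^ N) *
        (((i : ℝ) + 1) * ∑ j ∈ Finset.range (i + 1), ‖y j‖) := by gcongr
    _ = N * 2 ^ N * ((i : ℝ) + 1) ^ (N + 1) * ∑ j ∈ Finset.range (i + 1), ‖y j‖ := by ring

/-- The solution of the recursion for the partial sums of a solution `x` of `(z - C) x = y`. -/
noncomputable def resolventSum (z : ℂ) (y : ℕ → ℂ) : ℕ → ℂ
  | 0 => 0
  | i + 1 => (z - 1 / ((i : ℂ) + 1))⁻¹ * (z * resolventSum z y i + y i)

namespace KotheMatrix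

variable {A : KotheMatrix}

open Lambda0

/-! ### The resolvent -/

theorem IsG1.weight_mul_recursion_le (hA : A.IsG1) (hN : IsNuclearSpace A.Lambda0) {z : ℂ}
    (hz : ∀ i : ℕ, z ≠ 1 / ((i : ℂ) + 1)) (n : ℕ) :
    ∃ (m : ℕ) (K : ℝ), 0 ≤ K ∧ ∀ S y : ℕ → ℂ, S 0 = 0 →
      (∀ i : ℕ, (z - 1 / ((i : ℂ) + 1)) * S (i + 1) = z * S i + y i) → ∀ i : ℕ,
      A.a n i * ‖S (i + 1)‖ ≤
        K * (((i + 1 : ℕ) : ℝ)⁻¹ * ∑ j ∈ Finset.range (i + 1), A.a m j * ‖y j‖) := by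
  obtain ⟨N, K, hK, hb⟩ := norm_le_of_recursion hz
  -- One more power of the index than the growth of `S` is spent on the averaging factor.
  obtain ⟨m, C, hC, hm⟩ := hA.pow_mul_weight_le hN (N + 1) n
  refine ⟨m, K * C, by positivity, fun S y hS0 hS i => ?_⟩
  have hsum : A.a m i * ∑ j ∈ Finset.range (i + 1), ‖y j‖ ≤
      ∑ j ∈ Finset.range (i + 1), A.a m j * ‖y j‖ := by
    rw [Finset.mul_sum]
    exact Finset.sum_le_sum fun j hj => mul_le_mul_of_nonneg_right
      (hA.antitone m (Nat.lt_succ_iff.mp (Finset.mem_range.mp hj))) (norm_nonneg _)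
  have hY : 0 ≤ ∑ j ∈ Finset.range (i + 1), ‖y j‖ := Finset.sum_nonneg fun _ _ => norm_nonneg _
  push_cast
  calc A.a n i * ‖S (i + 1)‖
      ≤ A.a n i * (K * ((i : ℝ) + 1) ^ N * ∑ j ∈ Finset.range (i + 1), ‖y j‖) :=
        mul_le_mul_of_nonneg_left (hb S y hS0 hS i) (A.nonneg n i)
    _ = K * ((i : ℝ) + 1)⁻¹ * (((i : ℝ) + 1) ^ (N + 1) * A.a n i) *
          ∑ j ∈ Finset.range (i + 1), ‖y j‖ := by
        rw [pow_succ]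
        field_simp
    _ ≤ K * ((i : ℝ) + 1)⁻¹ * (C * A.a m i) * ∑ j ∈ Finset.range (i + 1), ‖y j‖ := by
        exact mul_le_mul_of_nonneg_right
          (mul_le_mul_of_nonneg_left (hm i) (by positivity)) hY
    _ = K * C * (((i : ℝ) + 1)⁻¹ * (A.a m i * ∑ j ∈ Finset.range (i + 1), ‖y j‖)) := by ring
    _ ≤ K * C * (((i : ℝ) + 1)⁻¹ * ∑ j ∈ Finset.range (i + 1), A.a m j * ‖y j‖) := by gcongr

theorem IsG1.weight_mul_le_of_succ (hA : A.IsG1) {n : ℕ} {S : ℕ → ℂ} (hS0 : S 0 = 0) {B : ℝ}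
    (hB : ∀ i, A.a n i * ‖S (i + 1)‖ ≤ B) (i : ℕ) : A.a n i * ‖S i‖ ≤ B := by
  cases i with
  | zero =>
    rw [hS0, norm_zero, mul_zero]
    exact (mul_nonneg (A.nonneg n 0) (norm_nonneg _)).trans (hB 0)
  | succ i => exact (mul_le_mul_of_nonneg_right (hA.anti n i) (norm_nonneg _)).trans (hB i)

theorem seq_smul_sub_cesaro (hA : A.IsG1) (z : ℂ) (x : Lambda0 A) (i : ℕ) :
    seq (z • x - A.cesaro hA x) i =
      z * seq x i - (∑ j ∈ Finset.range (i + 1), seq x j) / ((i : ℂ) + 1) := by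
  rw [map_sub, map_smul, Pi.sub_apply, seq_cesaro]
  rfl

theorem recursion_partialSum (hA : A.IsG1) (z : ℂ) (x : Lambda0 A) (i : ℕ) :
    (z - 1 / ((i : ℂ) + 1)) * ∑ j ∈ Finset.range (i + 1), seq x j =
      z * ∑ j ∈ Finset.range i, seq x j + seq (z • x - A.cesaro hA x) i := by
  rw [seq_smul_sub_cesaro, Finset.sum_range_succ]
  ring

theorem p_le_p_smul_sub_cesaro (hA : A.IsG1) (hN : IsNuclearSpace A.Lambda0) {z : ℂ}
    (hz : ∀ i : ℕ, z ≠ 1 / ((i : ℂ) + 1)) (n : ℕ) :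
    ∃ (m : ℕ) (K : ℝ), 0 ≤ K ∧ ∀ x : Lambda0 A, p A n x ≤ K * p A m (z • x - A.cesaro hA x) := by
  obtain ⟨m, K, hK, h⟩ := hA.weight_mul_recursion_le hN hz n
  refine ⟨m, 2 * K, by positivity, fun x => p_le fun i => ?_⟩
  set y := z • x - A.cesaro hA x
  have hS : ∀ i, A.a n i * ‖∑ j ∈ Finset.range (i + 1), seq x j‖ ≤ K * p A m y := by
    intro i
    refine (h (fun k => ∑ j ∈ Finset.range k, seq x j) (seq y) (by simp)
      (recursion_partialSum hA z x) i).trans (mul_le_mul_of_nonneg_left ?_ hK)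
    rw [inv_mul_le_iff₀ (by positivity)]
    refine (Finset.sum_le_card_nsmul _ _ _ fun j _ => weight_mul_norm_le_p y m j).trans_eq ?_
    rw [Finset.card_range, nsmul_eq_mul]
  have hS' := hA.weight_mul_le_of_succ (S := fun k => ∑ j ∈ Finset.range k, seq x j) (by simp) hS i
  have hx : seq x i = ∑ j ∈ Finset.range (i + 1), seq x j - ∑ j ∈ Finset.range i, seq x j := by
    rw [Finset.sum_range_succ, add_sub_cancel_left]
  have h1 := mul_le_mul_of_nonneg_left
    (norm_sub_le (∑ j ∈ Finset.range (i + 1), seq x j) (∑ j ∈ Finset.range i, seq x j))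
    (A.nonneg n i)
  rw [← hx, mul_add] at h1
  linarith [hS i]

theorem surjective_smul_sub_cesaro (hA : A.IsG1) (hN : IsNuclearSpace A.Lambda0) {z : ℂ}
    (hz : ∀ i : ℕ, z ≠ 1 / ((i : ℂ) + 1)) (y : Lambda0 A) :
    ∃ x : Lambda0 A, z • x - A.cesaro hA x = y := by
  set S := resolventSum z (seq y)
  have hrec : ∀ i : ℕ, (z - 1 / ((i : ℂ) + 1)) * S (i + 1) = z * S i + seq y i := fun i =>
    mul_inv_cancel_left₀ (sub_ne_zero.mpr (hz i)) _
  have htend : ∀ n, Tendsto (fun i => A.a n i * ‖S (i + 1)‖) atTop (𝓝 0) := by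
    intro n
    obtain ⟨m, K, -, h⟩ := hA.weight_mul_recursion_le hN hz n
    have hc := (((tendsto_norm y m).cesaro).comp (tendsto_add_atTop_nat 1)).const_mul K
    rw [mul_zero] at hc
    exact squeeze_zero (fun i => mul_nonneg (A.nonneg n i) (norm_nonneg _))
      (fun i => h S (seq y) rfl hrec i) hc
  have htend' : ∀ n, Tendsto (fun i => A.a n i * ‖S i‖) atTop (𝓝 0) := by
    intro n
    rw [← tendsto_add_atTop_iff_nat 1]
    exact squeeze_zero (fun i => mul_nonneg (A.nonneg n _) (norm_nonneg _))
      (fun i => mul_le_mul_of_nonneg_right (hA.anti n i) (norm_nonneg _)) (htend n)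
  let x : Lambda0 A := Lambda0.mk (fun i => S (i + 1) - S i) fun n => by
    have h := (htend n).add (htend' n)
    rw [add_zero] at h
    refine squeeze_zero (fun i => mul_nonneg (A.nonneg n _) (norm_nonneg _)) (fun i => ?_) h
    rw [← mul_add]
    exact mul_le_mul_of_nonneg_left (norm_sub_le _ _) (A.nonneg n i)
  refine ⟨x, Lambda0.ext fun i => ?_⟩
  have hsum : ∑ j ∈ Finset.range (i + 1), seq x j = S (i + 1) := by
    have h0 : S 0 = 0 := rfl
    rw [show seq x = fun i => S (i + 1) - S i from rfl, Finset.sum_range_sub, h0, sub_zero]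
  rw [seq_smul_sub_cesaro, hsum, show seq x i = S (i + 1) - S i from rfl]
  linear_combination hrec i

theorem isUnit_algebraMap_sub_cesaro (hA : A.IsG1) (hN : IsNuclearSpace A.Lambda0) {z : ℂ}
    (hz : ∀ i : ℕ, z ≠ 1 / ((i : ℂ) + 1)) :
    IsUnit (algebraMap ℂ (Lambda0 A →L[ℂ] Lambda0 A) z - A.cesaro hA) := by
  set T := algebraMap ℂ (Lambda0 A →L[ℂ] Lambda0 A) z - A.cesaro hA with hT
  have hTx : ∀ x, T x = z • x - A.cesaro hA x := fun x => by
    rw [hT, Algebra.algebraMap_eq_smul_one]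
    rfl
  have hinj : Function.Injective T := by
    rw [injective_iff_map_eq_zero]
    intro x hx
    obtain ⟨m, K, -, h⟩ := p_le_p_smul_sub_cesaro hA hN hz 0
    have h0 := h x
    rw [← hTx, hx, map_zero, mul_zero] at h0
    refine Lambda0.ext fun i => ?_
    have h1 := (weight_mul_norm_le_p x 0 i).trans h0
    have h2 := nonpos_of_mul_nonpos_right h1 (hA.weight_pos 0 i)
    rw [norm_le_zero_iff.mp h2, map_zero, Pi.zero_apply]
  have hsurj : Function.Surjective T := fun y => by
    simpa only [hTx] using surjective_smul_sub_cesaro hA hN hz y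
  let e : Lambda0 A ≃ₗ[ℂ] Lambda0 A := LinearEquiv.ofBijective T.toLinearMap ⟨hinj, hsurj⟩
  have he : ∀ y, T (e.symm y) = y := e.apply_symm_apply
  have hcont : Continuous e.symm.toLinearMap := by
    refine WithSeminorms.continuous_of_isBounded (withSeminorms A) (withSeminorms A) _ fun n => ?_
    obtain ⟨m, K, hK, h⟩ := p_le_p_smul_sub_cesaro hA hN hz n
    refine ⟨{m}, ⟨K, hK⟩, fun y => ?_⟩
    have h1 := h (e.symm y)
    rw [← hTx, he] at h1
    rw [Finset.sup_singleton]
    exact h1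
  let R : Lambda0 A →L[ℂ] Lambda0 A := ⟨e.symm.toLinearMap, hcont⟩
  exact ⟨⟨T, R, ContinuousLinearMap.ext he, ContinuousLinearMap.ext e.symm_apply_apply⟩, rfl⟩

/-! ### The points of the spectrum -/

/-- The matrix of `1 / (k + 1) - C` is lower triangular with diagonal entries that are nonzero before
position `k` and zero in position `k`. -/
theorem smul_sub_cesaro_ne_unit (hA : A.IsG1) (k : ℕ) (x : Lambda0 A) :
    (1 / ((k : ℂ) + 1)) • x - A.cesaro hA x ≠ unit A k := by
  intro h
  have hrec := fun i => recursion_partialSum hA (1 / ((k : ℂ) + 1)) x i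
  simp only [h, seq_unit] at hrec
  have hzero : ∀ i ≤ k, ∑ j ∈ Finset.range i, seq x j = 0 := by
    intro i
    induction i with
    | zero => simp
    | succ i ih =>
      intro hi
      have h1 := hrec i
      rw [ih (by omega), Pi.single_eq_of_ne (by omega), mul_zero, add_zero] at h1
      refine (mul_eq_zero.mp h1).resolve_left fun h2 => ?_
      rw [sub_eq_zero, one_div, one_div, inv_inj, add_left_inj, Nat.cast_inj] at h2
      omega
  have h1 := hrec k
  rw [hzero k le_rfl, sub_self, Pi.single_eq_same] at h1
  simp at h1

end KotheMatrix

/-- If `λ₀(A)` is a nuclear `G₁`-space, the spectrum of the Cesàro operator in the algebra of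
continuous linear operators on `λ₀(A)` is `{1 / k : k = 1, 2, ...}`. -/
theorem mainTheorem3 (A : KotheMatrix) (hA : A.IsG1) (hN : IsNuclearSpace A.Lambda0) :
    spectrum ℂ (A.cesaro hA) = {z : ℂ | ∃ k : ℕ, 1 ≤ k ∧ z = 1 / (k : ℂ)} := by
  ext z
  rw [spectrum.mem_iff, Set.mem_ofPred_eq]
  constructor
  · intro hz
    by_contra hne
    refine hz (KotheMatrix.isUnit_algebraMap_sub_cesaro hA hN fun i hi => hne ⟨i + 1, by omega, ?_⟩)
    rw [hi]
    push_cast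
    rfl
  · rintro ⟨k, hk, rfl⟩ ⟨u, hu⟩
    obtain ⟨k, rfl⟩ := Nat.exists_eq_add_of_le' hk
    push_cast at hu
    refine KotheMatrix.smul_sub_cesaro_ne_unit hA k (u⁻¹.1 (KotheMatrix.Lambda0.unit A k)) ?_
    have h := congrArg (fun T => T (KotheMatrix.Lambda0.unit A k)) u.mul_inv
    rw [hu, Algebra.algebraMap_eq_smul_one] at h
    exact h
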